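/- For $n\ge 1$ and $\mu\in(-1,1)^n$ let $D_\mu(x)=\prod_{i=1}^n\frac{1+x_i\mu_i}{2}$ be the $\mu$-biased product distribution on $\{-1,1\}^n$; it is called $c$-bounded, for $c\in(0,1]$, if $\mu\in[-1+c,1-c]^n$. For $a\in\{0,1\}^n$ let $f^{(a)}(x)=\sum_{i=1}^n a_i\frac{1-x_i}{2} \bmod 2$ and let $|\psi_a\rangle=\sum_{x\in\{-1,1\}^n}\sqrt{D_\mu(x)}\,|x,f^{(a)}(x)\rangle$ be the corresponding $(n+1)$-qubit quantum example state. A quantum learning algorithm receives $m$ copies of $|\psi_a\rangle$, may adjoin work qubits in state $|0\rangle$, applies a unitary, measures in the computational basis and computes its output from the measurement result. There is a universal constant $C>0$ such that for all $n\ge1$ and all $m$ there is a quantum learning algorithm, depending only on $n$ and $m$ (in particular it uses no prior knowledge of the distribution), with the following property. Let $\varepsilon\in(0,\frac12)$, $\delta\in(0,1)$ and $c\in(0,1]$ with $c>1-\sqrt{\frac{1-2\varepsilon}{2n}}$, and suppose that $$m\ \ge\ C\left(n^4\ln\frac1\delta+\max\left\{\frac{1}{(1-2\varepsilon)^2},\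 \frac{1}{1-2\left(n(1-c)^2+\varepsilon\right)^2}\right\}\ln\frac1\delta\right).$$ Then for every $a\in\{0,1\}^n$ and every $\mu\in(-1,1)^n$ such that $D_\mu$ is $c$-bounded, the algorithm, run on $m$ copies of $|\psi_a\rangle$, outputs $a$ with probability at least $1-\delta$. -/

import Mathlib

namespace BiasedParity

/-- The Boolean cube `{-1,1}^n`; the units of `ℤ` are exactly `1` and `-1`. -/
abbrev Cube (n : ℕ) : Type := Fin n → ℤˣ

/-- Bit strings `{0,1}^n`. -/
abbrev Bits (n : ℕ) : Type := Fin n → ZMod 2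

/-- The `μ`-biased product distribution `D_μ(x) = ∏ i, (1 + x_i μ_i) / 2` on the cube. -/
noncomputable def biasedDist {n : ℕ} (μ : Fin n → ℝ) (x : Cube n) : ℝ :=
  ∏ i, (1 + ((x i : ℤ) : ℝ) * μ i) / 2

/-- `D_μ` is `c`-bounded: `μ ∈ [-1 + c, 1 - c]^n`. -/
def CBounded {n : ℕ} (c : ℝ) (μ : Fin n → ℝ) : Prop :=
  ∀ i, μ i ∈ Set.Icc (-1 + c) (1 - c)

/-- The linear Boolean function `f^(a)(x) = ∑ i, a_i (1 - x_i) / 2 mod 2`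
(the integer division is exact, since `x_i = 1` or `x_i = -1`). -/
def parity {n : ℕ} (a : Bits n) (x : Cube n) : ZMod 2 :=
  ∑ i, a i * (((1 - (x i : ℤ)) / 2 : ℤ) : ZMod 2)

/-- Computational basis labels `(x, b)` of one `(n+1)`-qubit quantum example. -/
abbrev ExampleLabel (n : ℕ) : Type := Cube n × ZMod 2

/-- Amplitudes, in the computational basis, of the quantum example state
`|ψ_a⟩ = ∑ x, √(D_μ(x)) |x, f^(a)(x)⟩`. -/
noncomputable def exampleState {n : ℕ} (μ : Fin n → ℝ) (a : Bits n) (p : ExampleLabel n) : ℂ :=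
  if p.2 = parity a p.1 then ((Real.sqrt (biasedDist μ p.1) : ℝ) : ℂ) else 0

/-- Computational basis labels of `m` quantum examples together with `k` work qubits. -/
abbrev RegisterLabel (n m k : ℕ) : Type := (Fin m → ExampleLabel n) × Bits k

/-- A quantum algorithm that processes `m` quantum examples: it adjoins `work` ancilla qubits in
state `|0⟩`, applies a unitary to the joint system, measures every qubit in the computational
basis, and computes its output (a bit string, or `none` for failure) from the measurement
result. Adaptive intermediate measurements and private randomness are covered, by deferring
measurements with the help of the work qubits. -/
structure QuantumLearner (n m : ℕ) where
  work : ℕ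
  gate : Matrix.unitaryGroup (RegisterLabel n m work) ℂ
  output : RegisterLabel n m work → Option (Bits n)

/-- Amplitudes of the product state `|φ⟩ ⊗ ⋯ ⊗ |φ⟩ ⊗ |0 ⋯ 0⟩` (`m` copies of `|φ⟩` and
`k` work qubits). -/
def inputState {n : ℕ} (φ : ExampleLabel n → ℂ) (m k : ℕ) (s : RegisterLabel n m k) : ℂ :=
  (∏ l, φ (s.1 l)) * (if s.2 = 0 then 1 else 0)

/-- The probability that the algorithm, run on `m` copies of `|φ⟩`, outputs the string `b`. -/
noncomputable def QuantumLearner.outputProb {n m : ℕ} (A : QuantumLearner n m)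
    (φ : ExampleLabel n → ℂ) (b : Bits n) : ℝ :=
  ∑ s with A.output s = some b,
    ‖((A.gate : Matrix (RegisterLabel n m A.work) (RegisterLabel n m A.work) ℂ).mulVec
      (inputState φ m A.work)) s‖ ^ 2

end BiasedParity

/-!
The learner ignores the bias: it applies a Hadamard gate to every one of the `m (n + 1)` qubits and
takes a majority vote. The bounds on `ε` and `c` enter only through their consequence
`∑ i, μ i ^ 2 < 1 / 2`.

Take one example state. After the Hadamard gates the last qubit (the flag) reads `0` or `1`
with probability `1 / 2` each (`sum_outcomeProb_flag`), because the gates on the other `n` qubits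
preserve the norm. When the flag reads `1`, the phase `(-1) ^ f^(a)(x)` that it leaves behind is the
character of the cube indexed by `a`, so the amplitude of reading `a` in the other qubits is, up to
the factor `1 / √2`, the overlap of `√D_μ` with the uniform state. The square of this overlap is
`∏ i, (1 + √(1 - μ i ^ 2)) / 2 ≥ 1 - (∑ i, μ i ^ 2) / 2 ≥ 3 / 4`. Hence one copy yields the string
`a` with the flag raised with probability at least `3 / 8` (`le_outcomeProb_encode`), and a wrong
string with the flag raised with probability at most `1 / 8`.

The vote returns the string that makes up a strict majority of the flagged readings. It can differ
from `a` only if at least as many flagged readings are wrong as are right. Weighting a right reading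
by `1 / 2`, a wrong one by `2` and an unflagged one by `1`, such a sequence of readings has weight
at least `1`, so by independence its probability is at most
`(1 / 2 + (1 / 2) * (3 / 8) + 2 * (1 / 8)) ^ m = (15 / 16) ^ m ≤ exp (-m / 16)`. This exponential
bound holds for every `m`, hence covers values of `δ` close to `1` as well.
-/

namespace BiasedParity

open Matrix Kronecker

/-! ### Tensor powers of unitary matrices -/

theorem sum_pi_prod {κ ι R : Type*} [Fintype κ] [DecidableEq κ] [Fintype ι] [CommSemiring R]
    (f : κ → ι → R) : ∑ s : κ → ι, ∏ l, f l (s l) = ∏ l, ∑ i, f l i := by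
  rw [Finset.prod_univ_sum, Fintype.piFinset_univ]

/-- The tensor power `A ⊗ ⋯ ⊗ A`, with one factor for each element of `κ`, in the product basis. -/
def tensorPow (κ : Type*) {ι : Type*} [Fintype κ] (A : Matrix ι ι ℂ) :
    Matrix (κ → ι) (κ → ι) ℂ :=
  Matrix.of fun s t => ∏ l, A (s l) (t l)

theorem tensorPow_mulVec_prod {κ ι : Type*} [Fintype κ] [DecidableEq κ] [Fintype ι]
    (A : Matrix ι ι ℂ) (φ : κ → ι → ℂ) (s : κ → ι) :
    (tensorPow κ A *ᵥ fun t => ∏ l, φ l (t l)) s = ∏ l, (A *ᵥ φ l) (s l) := by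
  simp only [mulVec, dotProduct, tensorPow, of_apply, ← Finset.prod_mul_distrib]
  exact sum_pi_prod fun l i => A (s l) i * φ l i

theorem tensorPow_mem_unitaryGroup {κ ι : Type*} [Fintype κ] [DecidableEq κ] [Fintype ι]
    [DecidableEq ι] {A : Matrix ι ι ℂ} (hA : A ∈ unitaryGroup ι ℂ) :
    tensorPow κ A ∈ unitaryGroup (κ → ι) ℂ := by
  rw [mem_unitaryGroup_iff] at hA ⊢
  ext s t
  have h : (tensorPow κ A * star (tensorPow κ A)) s t = ∏ l, (A * star A) (s l) (t l) := by
    simp only [mul_apply, star_apply, tensorPow, of_apply, star_prod, ← Finset.prod_mul_distrib]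
    exact sum_pi_prod fun l i => A (s l) i * star (A (t l) i)
  rw [h, hA]
  simp only [one_apply, Finset.prod_ite_zero, Finset.prod_const_one, Finset.mem_univ,
    forall_true_left, funext_iff]

theorem sum_norm_sq_unitary_mulVec {ι : Type*} [Fintype ι] [DecidableEq ι] {U : Matrix ι ι ℂ}
    (hU : U ∈ unitaryGroup ι ℂ) (v : ι → ℂ) : ∑ i, ‖(U *ᵥ v) i‖ ^ 2 = ∑ i, ‖v i‖ ^ 2 := by
  have key : ∀ w : ι → ℂ, ((∑ i, ‖w i‖ ^ 2 : ℝ) : ℂ) = star w ⬝ᵥ w := fun w => by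
    simp [dotProduct, Complex.conj_mul']
  have h : star (U *ᵥ v) ⬝ᵥ (U *ᵥ v) = star v ⬝ᵥ v := by
    rw [star_mulVec, dotProduct_mulVec, vecMul_vecMul, ← star_eq_conjTranspose,
      mem_unitaryGroup_iff'.1 hU, vecMul_one]
  exact_mod_cast (key _).trans (h.trans (key _).symm)

/-! ### The Hadamard transform of one example -/

/-- The Hadamard gate in a basis labelled by `1` and `-1`. -/
noncomputable def signHadamard : Matrix ℤˣ ℤˣ ℂ :=
  Matrix.of fun u v => (((√2)⁻¹ : ℝ) : ℂ) * (if u = 1 then 1 else ((v : ℤ) : ℂ))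

/-- The Hadamard gate in a basis labelled by `ZMod 2`. -/
noncomputable def bitHadamard : Matrix (ZMod 2) (ZMod 2) ℂ :=
  Matrix.of fun b b' => (((√2)⁻¹ : ℝ) : ℂ) * (if b = 0 ∨ b' = 0 then 1 else -1)

theorem inv_sqrt_two_mul_self : (((√2)⁻¹ : ℝ) : ℂ) * (((√2)⁻¹ : ℝ) : ℂ) = 1 / 2 := by
  rw [← Complex.ofReal_mul, ← mul_inv, Real.mul_self_sqrt (by norm_num)]
  norm_num

theorem signHadamard_mem_unitaryGroup : signHadamard ∈ unitaryGroup ℤˣ ℂ := by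
  have h := inv_sqrt_two_mul_self
  rw [mem_unitaryGroup_iff]
  ext u v
  rcases Int.units_eq_one_or u with rfl | rfl <;> rcases Int.units_eq_one_or v with rfl | rfl <;>
    simp only [signHadamard, mul_apply, star_apply, of_apply, UnitsInt.univ, one_apply,
      Finset.sum_insert (show (1 : ℤˣ) ∉ ({-1} : Finset ℤˣ) by decide), Finset.sum_singleton,
      star_mul', RCLike.star_def, Complex.conj_ofReal] <;>
    simp [show (-1 : ℤˣ) ≠ 1 by decide, show (1 : ℤˣ) ≠ -1 by decide] <;>
    simp at h <;> linear_combination 2 * h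

theorem bitHadamard_mem_unitaryGroup : bitHadamard ∈ unitaryGroup (ZMod 2) ℂ := by
  have h := inv_sqrt_two_mul_self
  rw [mem_unitaryGroup_iff]
  ext u v
  have hu : (Finset.univ : Finset (ZMod 2)) = {0, 1} := by decide
  have h2 : ∀ z : ZMod 2, z = 0 ∨ z = 1 := by decide
  rcases h2 u with rfl | rfl <;> rcases h2 v with rfl | rfl <;>
    simp only [bitHadamard, mul_apply, star_apply, of_apply, hu, one_apply,
      Finset.sum_insert (show (0 : ZMod 2) ∉ ({1} : Finset (ZMod 2)) by decide),
      Finset.sum_singleton, star_mul', RCLike.star_def, Complex.conj_ofReal] <;>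
    simp <;>
    simp at h <;> linear_combination 2 * h

/-- The Hadamard gates on all `n + 1` qubits of one quantum example. -/
noncomputable def exampleHadamard (n : ℕ) : Matrix (ExampleLabel n) (ExampleLabel n) ℂ :=
  tensorPow (Fin n) signHadamard ⊗ₖ bitHadamard

theorem exampleHadamard_mem_unitaryGroup (n : ℕ) :
    exampleHadamard n ∈ unitaryGroup (ExampleLabel n) ℂ :=
  kronecker_mem_unitary (tensorPow_mem_unitaryGroup signHadamard_mem_unitaryGroup)
    bitHadamard_mem_unitaryGroup

/-- The probability of reading `p` when an example state is measured after the Hadamard gates. -/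
noncomputable def outcomeProb {n : ℕ} (μ : Fin n → ℝ) (a : Bits n) (p : ExampleLabel n) : ℝ :=
  ‖(exampleHadamard n *ᵥ exampleState μ a) p‖ ^ 2

/-- Seen from the first `n` qubits, reading the flag as `b` turns the example state into
`√D_μ` with the phase that the flag leaves behind. -/
theorem exampleHadamard_mulVec {n : ℕ} (μ : Fin n → ℝ) (a : Bits n) (y : Cube n) (b : ZMod 2) :
    (exampleHadamard n *ᵥ exampleState μ a) (y, b) =
      (tensorPow (Fin n) signHadamard *ᵥ fun x =>
        bitHadamard b (parity a x) * ((√(biasedDist μ x) : ℝ) : ℂ)) y := by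
  simp only [mulVec, dotProduct, exampleHadamard, kroneckerMap_apply, exampleState,
    Fintype.sum_prod_type, mul_ite, mul_zero, Finset.sum_ite_eq', Finset.mem_univ,
    if_true, mul_assoc]

/-! ### The distribution of one reading -/

theorem sum_units (f : ℤˣ → ℝ) : ∑ u, f u = f 1 + f (-1) := by
  rw [UnitsInt.univ, Finset.sum_insert (by decide), Finset.sum_singleton]

theorem one_add_unit_mul_pos {t : ℝ} (ht : t ∈ Set.Ioo (-1 : ℝ) 1) (u : ℤˣ) :
    0 < (1 + ((u : ℤ) : ℝ) * t) / 2 := by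
  rcases Int.units_eq_one_or u with rfl | rfl <;> simp <;> linarith [ht.1, ht.2]

theorem biasedDist_nonneg {n : ℕ} {μ : Fin n → ℝ} (hμ : ∀ i, μ i ∈ Set.Ioo (-1 : ℝ) 1)
    (x : Cube n) : 0 ≤ biasedDist μ x :=
  Finset.prod_nonneg fun i _ => (one_add_unit_mul_pos (hμ i) (x i)).le

theorem sum_biasedDist {n : ℕ} (μ : Fin n → ℝ) : ∑ x, biasedDist μ x = 1 := by
  simp only [biasedDist]
  rw [sum_pi_prod fun i (u : ℤˣ) => (1 + ((u : ℤ) : ℝ) * μ i) / 2]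
  refine Finset.prod_eq_one fun i _ => ?_
  rw [sum_units]
  simp
  ring

theorem norm_bitHadamard_sq (b b' : ZMod 2) : ‖bitHadamard b b'‖ ^ 2 = 1 / 2 := by
  simp only [bitHadamard, of_apply]
  split_ifs <;> simp

theorem sum_outcomeProb_flag {n : ℕ} {μ : Fin n → ℝ} (hμ : ∀ i, μ i ∈ Set.Ioo (-1 : ℝ) 1)
    (a : Bits n) (b : ZMod 2) : ∑ y, outcomeProb μ a (y, b) = 1 / 2 := by
  simp only [outcomeProb, exampleHadamard_mulVec]
  rw [sum_norm_sq_unitary_mulVec (tensorPow_mem_unitaryGroup signHadamard_mem_unitaryGroup)]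
  simp only [norm_mul, mul_pow, norm_bitHadamard_sq, Complex.norm_real, Real.norm_eq_abs, sq_abs,
    Real.sq_sqrt (biasedDist_nonneg hμ _), ← Finset.mul_sum, sum_biasedDist, mul_one]

/-- The reading of the first `n` qubits that stands for the bit string `a`. -/
def encode {n : ℕ} (a : Bits n) : Cube n := fun i => if a i = 0 then 1 else -1

theorem encode_injective {n : ℕ} : Function.Injective (encode : Bits n → Cube n) := by
  have h : ∀ z w : ZMod 2, (if z = 0 then (1 : ℤˣ) else -1) = (if w = 0 then 1 else -1) →
      z = w := by decide
  exact fun a b hab => funext fun i => h _ _ (congrFun hab i)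

theorem ite_sum_eq_prod_ite {ι : Type*} (s : Finset ι) (f : ι → ZMod 2) :
    (if ∑ i ∈ s, f i = 0 then (1 : ℂ) else -1) = ∏ i ∈ s, if f i = 0 then (1 : ℂ) else -1 := by
  classical
  induction s using Finset.induction_on with
  | empty => simp
  | insert i s hi ih =>
    rw [Finset.sum_insert hi, Finset.prod_insert hi, ← ih]
    have h2 : ∀ z : ZMod 2, z = 0 ∨ z = 1 := by decide
    rcases h2 (f i) with h | h <;> rcases h2 (∑ i ∈ s, f i) with h' | h' <;>
      simp [h, h', show (1 + 1 : ZMod 2) = 0 from rfl]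

/-- The phase `(-1) ^ f^(a)(x)` is, coordinate by coordinate, the phase with which the basis vector
`x` enters the row `encode a` of the Hadamard transform. -/
theorem phase_parity {n : ℕ} (a : Bits n) (x : Cube n) :
    (if parity a x = 0 then (1 : ℂ) else -1) =
      ∏ i, if encode a i = 1 then (1 : ℂ) else (((x i : ℤˣ) : ℤ) : ℂ) := by
  rw [parity, ite_sum_eq_prod_ite]
  refine Finset.prod_congr rfl fun i _ => ?_
  have h2 : ∀ z : ZMod 2, z = 0 ∨ z = 1 := by decide
  rcases h2 (a i) with h | h <;> rcases Int.units_eq_one_or (x i) with h' | h' <;>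
    simp [h, h', encode, show (-1 : ℤˣ) ≠ 1 by decide]

/-- The overlap of the one-qubit states `√((1 + t) / 2) |1⟩ + √((1 - t) / 2) |-1⟩` and
`(|1⟩ + |-1⟩) / √2`. -/
noncomputable def overlap (t : ℝ) : ℝ := (√2)⁻¹ * (√((1 + t) / 2) + √((1 - t) / 2))

theorem one_sub_le_overlap_sq {t : ℝ} (ht : t ∈ Set.Ioo (-1 : ℝ) 1) :
    1 - t ^ 2 / 2 ≤ overlap t ^ 2 := by
  have h1 : 0 ≤ (1 + t) / 2 := by linarith [ht.1]
  have h2 : 0 ≤ (1 - t) / 2 := by linarith [ht.2]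
  -- Since `(1 - t ^ 2) / 4 ≤ 1 / 4`, twice this number is at most its square root.
  have h3 : 2 * ((1 + t) / 2 * ((1 - t) / 2)) ≤ √((1 + t) / 2) * √((1 - t) / 2) := by
    rw [← Real.sqrt_mul h1]
    exact Real.le_sqrt_of_sq_le (by nlinarith [mul_nonneg h1 h2, sq_nonneg t])
  have h4 : overlap t ^ 2 = ((1 + t) / 2 + (1 - t) / 2
      + 2 * (√((1 + t) / 2) * √((1 - t) / 2))) / 2 := by
    rw [overlap, mul_pow, inv_pow, Real.sq_sqrt (by norm_num), add_sq, Real.sq_sqrt h1,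
      Real.sq_sqrt h2]
    ring
  rw [h4]
  linarith

theorem exampleHadamard_mulVec_encode {n : ℕ} {μ : Fin n → ℝ}
    (hμ : ∀ i, μ i ∈ Set.Ioo (-1 : ℝ) 1) (a : Bits n) :
    (exampleHadamard n *ᵥ exampleState μ a) (encode a, 1) =
      (((√2)⁻¹ * ∏ i, overlap (μ i) : ℝ) : ℂ) := by
  have hsq : ∀ u : ℤˣ, ((u : ℤ) : ℂ) * ((u : ℤ) : ℂ) = 1 := fun u => by
    rcases Int.units_eq_one_or u with rfl | rfl <;> simp
  have hterm : ∀ x : Cube n, tensorPow (Fin n) signHadamard (encode a) x *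
      (bitHadamard 1 (parity a x) * ((√(biasedDist μ x) : ℝ) : ℂ)) =
      (((√2)⁻¹ * ∏ i, ((√2)⁻¹ * √((1 + ((x i : ℤ) : ℝ) * μ i) / 2)) : ℝ) : ℂ) := fun x => by
    have hb : bitHadamard 1 (parity a x) = (((√2)⁻¹ : ℝ) : ℂ) *
        ∏ i, if encode a i = 1 then (1 : ℂ) else (((x i : ℤˣ) : ℤ) : ℂ) := by
      rw [← phase_parity]
      simp [bitHadamard]
    rw [hb, biasedDist, Real.sqrt_prod _ fun i _ => (one_add_unit_mul_pos (hμ i) (x i)).le]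
    push_cast
    rw [mul_assoc, mul_left_comm, tensorPow, of_apply, ← Finset.prod_mul_distrib,
      ← Finset.prod_mul_distrib]
    congr 1
    refine Finset.prod_congr rfl fun i _ => ?_
    simp only [signHadamard, of_apply]
    split_ifs
    · push_cast; ring
    · push_cast; linear_combination ((√2 : ℝ) : ℂ)⁻¹ *
        ((√((1 + ((x i : ℤ) : ℝ) * μ i) / 2) : ℝ) : ℂ) * hsq (x i)
  rw [exampleHadamard_mulVec]
  simp only [mulVec, dotProduct, hterm]
  rw [← Complex.ofReal_sum, ← Finset.mul_sum,
    sum_pi_prod fun i (u : ℤˣ) => (√2)⁻¹ * √((1 + ((u : ℤ) : ℝ) * μ i) / 2)]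
  congr 2
  refine Finset.prod_congr rfl fun i _ => ?_
  rw [sum_units, overlap]
  simp only [Units.val_one, Int.cast_one, one_mul, Units.val_neg, Int.cast_neg, neg_mul,
    ← sub_eq_add_neg, mul_add]

theorem one_sub_sum_le_prod_one_sub {ι : Type*} (s : Finset ι) {t : ι → ℝ}
    (h0 : ∀ i, 0 ≤ t i) (h1 : ∀ i, t i ≤ 1) : 1 - ∑ i ∈ s, t i ≤ ∏ i ∈ s, (1 - t i) := by
  classical
  induction s using Finset.induction_on with
  | empty => simp
  | insert i s hi ih =>
    rw [Finset.sum_insert hi, Finset.prod_insert hi]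
    have hs : ∏ i ∈ s, (1 - t i) ≤ 1 :=
      Finset.prod_le_one (fun i _ => by linarith [h1 i]) fun i _ => by linarith [h0 i]
    nlinarith [h0 i]

theorem le_outcomeProb_encode {n : ℕ} {μ : Fin n → ℝ} (hμ : ∀ i, μ i ∈ Set.Ioo (-1 : ℝ) 1)
    (hsum : ∑ i, μ i ^ 2 ≤ 1 / 2) (a : Bits n) : 3 / 8 ≤ outcomeProb μ a (encode a, 1) := by
  have hsq : ∀ i, μ i ^ 2 ≤ 1 := fun i => by nlinarith [(hμ i).1, (hμ i).2]
  have h1 : 1 - ∑ i, μ i ^ 2 / 2 ≤ ∏ i, (1 - μ i ^ 2 / 2) :=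
    one_sub_sum_le_prod_one_sub _ (fun i => by positivity) fun i => by linarith [hsq i]
  have h2 : ∏ i, (1 - μ i ^ 2 / 2) ≤ ∏ i, overlap (μ i) ^ 2 :=
    Finset.prod_le_prod (fun i _ => by linarith [hsq i]) fun i _ => one_sub_le_overlap_sq (hμ i)
  rw [outcomeProb, exampleHadamard_mulVec_encode hμ, Complex.norm_real, Real.norm_eq_abs, sq_abs,
    mul_pow, ← Finset.prod_pow, inv_pow, Real.sq_sqrt (by norm_num)]
  rw [← Finset.sum_div] at h1
  linarith

/-! ### The majority vote -/

/-- The number of raised flags with the reading `b`. -/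
def rightCount {n m : ℕ} (b : Bits n) (r : Fin m → ExampleLabel n) : ℕ :=
  Finset.card {l | (r l).2 = 1 ∧ (r l).1 = encode b}

/-- The number of raised flags with a reading other than `b`. -/
def wrongCount {n m : ℕ} (b : Bits n) (r : Fin m → ExampleLabel n) : ℕ :=
  Finset.card {l | (r l).2 = 1 ∧ (r l).1 ≠ encode b}

theorem rightCount_le_wrongCount {n m : ℕ} {a b : Bits n} (hab : a ≠ b)
    (r : Fin m → ExampleLabel n) : rightCount a r ≤ wrongCount b r :=
  Finset.card_le_card fun l hl => by
    simp only [Finset.mem_filter, Finset.mem_univ, true_and] at hl ⊢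
    exact ⟨hl.1, hl.2 ▸ fun h => hab (encode_injective h)⟩

open Classical in
/-- The string that a strict majority of the flagged readings agree on, if there is one. -/
noncomputable def majority {n m : ℕ} (r : Fin m → ExampleLabel n) : Option (Bits n) :=
  if h : ∃ b : Bits n, wrongCount b r < rightCount b r then some h.choose else none

theorem majority_eq_some {n m : ℕ} {a : Bits n} {r : Fin m → ExampleLabel n}
    (h : wrongCount a r < rightCount a r) : majority r = some a := by
  have hex : ∃ b : Bits n, wrongCount b r < rightCount b r := ⟨a, h⟩
  rw [majority, dif_pos hex]
  by_contra hne
  have hne' : a ≠ hex.choose := fun h' => hne (congrArg some h'.symm)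
  have h1 := hex.choose_spec
  have h2 := rightCount_le_wrongCount hne' r
  have h3 := rightCount_le_wrongCount hne'.symm r
  omega

/-- Hadamard gates on the qubits of all examples, no work qubits, and the majority vote. -/
noncomputable def hadamardLearner (n m : ℕ) : QuantumLearner n m where
  work := 0
  gate := ⟨tensorPow (Fin m) (exampleHadamard n) ⊗ₖ (1 : Matrix (Bits 0) (Bits 0) ℂ),
    kronecker_mem_unitary (tensorPow_mem_unitaryGroup (exampleHadamard_mem_unitaryGroup n))
      (one_mem _)⟩
  output s := majority s.1

theorem outputProb_hadamardLearner {n m : ℕ} (μ : Fin n → ℝ) (a b : Bits n) :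
    (hadamardLearner n m).outputProb (exampleState μ a) b =
      ∑ r : Fin m → ExampleLabel n with majority r = some b, ∏ l, outcomeProb μ a (r l) := by
  have hamp : ∀ (r : Fin m → ExampleLabel n) (z : Bits 0),
      ((tensorPow (Fin m) (exampleHadamard n) ⊗ₖ (1 : Matrix (Bits 0) (Bits 0) ℂ)) *ᵥ
        inputState (exampleState μ a) m 0) (r, z) =
      ∏ l, (exampleHadamard n *ᵥ exampleState μ a) (r l) := fun r z => by
    rw [← tensorPow_mulVec_prod]
    obtain rfl : z = 0 := Subsingleton.elim _ _
    simp only [mulVec, dotProduct, inputState, Fintype.sum_prod_type, kroneckerMap_apply]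
    refine Finset.sum_congr rfl fun t _ => ?_
    rw [Finset.sum_eq_single (0 : Bits 0) (fun w _ hw => absurd (Subsingleton.elim w 0) hw)
      (fun h => absurd (Finset.mem_univ _) h), one_apply_eq, mul_one, if_pos rfl, mul_one]
  rw [QuantumLearner.outputProb, Finset.sum_filter, Finset.sum_filter]
  change (∑ s : (Fin m → ExampleLabel n) × Bits 0, if majority s.1 = some b then
    ‖((tensorPow (Fin m) (exampleHadamard n) ⊗ₖ (1 : Matrix (Bits 0) (Bits 0) ℂ)) *ᵥ
      inputState (exampleState μ a) m 0) s‖ ^ 2 else 0) = _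
  rw [Fintype.sum_prod_type]
  refine Finset.sum_congr rfl fun r _ => ?_
  rw [Fintype.sum_unique]
  simp only [hamp, outcomeProb, norm_prod, Finset.prod_pow]

/-- The weight of one reading in the exponential moment bound. -/
noncomputable def weight {n : ℕ} (a : Bits n) (p : ExampleLabel n) : ℝ :=
  (if p.2 = 1 ∧ p.1 = encode a then 1 / 2 else 1) * (if p.2 = 1 ∧ p.1 ≠ encode a then 2 else 1)

theorem weight_nonneg {n : ℕ} (a : Bits n) (p : ExampleLabel n) : 0 ≤ weight a p := by
  unfold weight
  split_ifs <;> norm_num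

theorem one_le_prod_weight {n m : ℕ} {a : Bits n} {r : Fin m → ExampleLabel n}
    (h : rightCount a r ≤ wrongCount a r) : 1 ≤ ∏ l, weight a (r l) := by
  simp only [weight, Finset.prod_mul_distrib, Finset.prod_ite, Finset.prod_const, one_pow,
    mul_one]
  change 1 ≤ (1 / 2 : ℝ) ^ rightCount a r * 2 ^ wrongCount a r
  rw [one_div, inv_pow, inv_mul_eq_div, one_le_div (by positivity)]
  exact pow_le_pow_right₀ (by norm_num) h

theorem sum_outcomeProb_mul_weight_le {n : ℕ} {μ : Fin n → ℝ}
    (hμ : ∀ i, μ i ∈ Set.Ioo (-1 : ℝ) 1) (hsum : ∑ i, μ i ^ 2 ≤ 1 / 2) (a : Bits n) :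
    ∑ p, outcomeProb μ a p * weight a p ≤ 15 / 16 := by
  have h0 : ∑ y, outcomeProb μ a (y, 0) * weight a (y, 0) = 1 / 2 := by
    simpa [weight] using sum_outcomeProb_flag hμ a 0
  have h1 : ∑ y, outcomeProb μ a (y, 1) * weight a (y, 1) =
      2 * (1 / 2) - 3 / 2 * outcomeProb μ a (encode a, 1) := by
    have hw : ∀ y, outcomeProb μ a (y, 1) * weight a (y, 1) = 2 * outcomeProb μ a (y, 1) -
        if y = encode a then 3 / 2 * outcomeProb μ a (encode a, 1) else 0 := fun y => by
      by_cases hy : y = encode a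
      · simp [weight, hy]; ring
      · simp [weight, hy]; ring
    simp only [hw, Finset.sum_sub_distrib, ← Finset.mul_sum, sum_outcomeProb_flag hμ,
      Finset.sum_ite_eq', Finset.mem_univ, if_true]
  have hu : (Finset.univ : Finset (ZMod 2)) = {0, 1} := by decide
  have := le_outcomeProb_encode hμ hsum a
  rw [Fintype.sum_prod_type_right, hu, Finset.sum_insert (by decide), Finset.sum_singleton, h0, h1]
  linarith

theorem one_sub_pow_le_outputProb {n : ℕ} (m : ℕ) {μ : Fin n → ℝ}
    (hμ : ∀ i, μ i ∈ Set.Ioo (-1 : ℝ) 1) (hsum : ∑ i, μ i ^ 2 ≤ 1 / 2) (a : Bits n) :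
    1 - (15 / 16 : ℝ) ^ m ≤ (hadamardLearner n m).outputProb (exampleState μ a) a := by
  have hP : ∀ p, 0 ≤ outcomeProb μ a p := fun p => sq_nonneg _
  have hu : (Finset.univ : Finset (ZMod 2)) = {0, 1} := by decide
  have htotal : ∑ r : Fin m → ExampleLabel n, ∏ l, outcomeProb μ a (r l) = 1 := by
    rw [sum_pi_prod fun _ p => outcomeProb μ a p]
    refine Finset.prod_eq_one fun _ _ => ?_
    rw [Fintype.sum_prod_type_right, hu, Finset.sum_insert (by decide), Finset.sum_singleton,
      sum_outcomeProb_flag hμ, sum_outcomeProb_flag hμ]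
    norm_num
  have hfail : ∑ r : Fin m → ExampleLabel n with ¬ majority r = some a,
      ∏ l, outcomeProb μ a (r l) ≤ (15 / 16 : ℝ) ^ m :=
    calc ∑ r : Fin m → ExampleLabel n with ¬ majority r = some a, ∏ l, outcomeProb μ a (r l)
        ≤ ∑ r : Fin m → ExampleLabel n with ¬ majority r = some a,
            ∏ l, (outcomeProb μ a (r l) * weight a (r l)) := by
          refine Finset.sum_le_sum fun r hr => ?_
          rw [Finset.prod_mul_distrib]
          refine le_mul_of_one_le_right (Finset.prod_nonneg fun l _ => hP _)
            (one_le_prod_weight ?_)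
          by_contra hlt
          exact (Finset.mem_filter.1 hr).2 (majority_eq_some (not_le.1 hlt))
      _ ≤ ∑ r : Fin m → ExampleLabel n, ∏ l, (outcomeProb μ a (r l) * weight a (r l)) :=
          Finset.sum_le_univ_sum_of_nonneg fun r =>
            Finset.prod_nonneg fun l _ => mul_nonneg (hP _) (weight_nonneg _ _)
      _ = (∑ p, outcomeProb μ a p * weight a p) ^ m := by
          rw [sum_pi_prod fun _ p => outcomeProb μ a p * weight a p, Finset.prod_const,
            Finset.card_univ, Fintype.card_fin]
      _ ≤ (15 / 16 : ℝ) ^ m :=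
          pow_le_pow_left₀ (Finset.sum_nonneg fun p _ => mul_nonneg (hP _) (weight_nonneg _ _))
            (sum_outcomeProb_mul_weight_le hμ hsum a) m
  rw [outputProb_hadamardLearner]
  have := Finset.sum_filter_add_sum_filter_not Finset.univ
    (fun r : Fin m → ExampleLabel n => majority r = some a) fun r => ∏ l, outcomeProb μ a (r l)
  linarith

/-! ### The number of copies -/

theorem sum_sq_le_half {n : ℕ} (hn : 1 ≤ n) {ε c : ℝ} (hε : 0 < ε) (hε' : ε < 1 / 2) (hc : c ≤ 1)
    (hcε : c > 1 - √((1 - 2 * ε) / (2 * (n : ℝ)))) {μ : Fin n → ℝ} (hμ : CBounded c μ) :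
    ∑ i, μ i ^ 2 ≤ 1 / 2 := by
  have hn' : (0 : ℝ) < n := by exact_mod_cast hn
  have hsq : (1 - c) ^ 2 ≤ (1 - 2 * ε) / (2 * (n : ℝ)) := by
    rw [← Real.sq_sqrt (div_nonneg (by linarith) (by linarith) :
      0 ≤ (1 - 2 * ε) / (2 * (n : ℝ)))]
    exact pow_le_pow_left₀ (by linarith) (by linarith) 2
  calc ∑ i, μ i ^ 2 ≤ ∑ _i : Fin n, (1 - 2 * ε) / (2 * (n : ℝ)) :=
        Finset.sum_le_sum fun i _ => by
          have h := hμ i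
          exact (sq_le_sq' (by linarith [h.1]) h.2).trans hsq
    _ = (1 - 2 * ε) / 2 := by
        rw [Finset.sum_const, Finset.card_univ, Fintype.card_fin, nsmul_eq_mul]
        field_simp
    _ ≤ 1 / 2 := by linarith

end BiasedParity

theorem mainTheorem10 :
    ∃ C : ℝ, 0 < C ∧ ∀ n m : ℕ, 1 ≤ n →
      ∃ A : BiasedParity.QuantumLearner n m,
        ∀ ε c δ : ℝ, 0 < ε → ε < 1 / 2 → 0 < c → c ≤ 1 → 0 < δ → δ < 1 →
          c > 1 - Real.sqrt ((1 - 2 * ε) / (2 * (n : ℝ))) →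
          C * ((n : ℝ) ^ 4 * Real.log (1 / δ)
              + max (1 / (1 - 2 * ε) ^ 2) (1 / (1 - 2 * ((n : ℝ) * (1 - c) ^ 2 + ε) ^ 2))
                * Real.log (1 / δ)) ≤ (m : ℝ) →
          ∀ (a : BiasedParity.Bits n) (μ : Fin n → ℝ),
            (∀ i, μ i ∈ Set.Ioo (-1 : ℝ) 1) → BiasedParity.CBounded c μ →
              1 - δ ≤ A.outputProb (BiasedParity.exampleState μ a) a := by
  refine ⟨16, by norm_num, fun n m hn => ⟨BiasedParity.hadamardLearner n m, ?_⟩⟩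
  intro ε c δ hε hε' _ hc hδ hδ' hcε hm a μ hμ hcμ
  refine le_trans ?_ (BiasedParity.one_sub_pow_le_outputProb m hμ
    (BiasedParity.sum_sq_le_half hn hε hε' hc hcε hcμ) a)
  have hL : 0 ≤ Real.log (1 / δ) := Real.log_nonneg (by rw [le_div_iff₀ hδ]; linarith)
  have hn4 : (1 : ℝ) ≤ (n : ℝ) ^ 4 := one_le_pow₀ (by exact_mod_cast hn)
  have hmax : 0 ≤ max (1 / (1 - 2 * ε) ^ 2) (1 / (1 - 2 * ((n : ℝ) * (1 - c) ^ 2 + ε) ^ 2)) :=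
    le_max_of_le_left (by positivity)
  -- The term with `n ^ 4` alone already provides enough copies.
  have hmL : 16 * Real.log (1 / δ) ≤ m := by
    nlinarith [mul_nonneg hmax hL, mul_le_mul_of_nonneg_right hn4 hL]
  have hlog : -(m / 16 : ℝ) ≤ Real.log δ := by
    rw [one_div, Real.log_inv] at hmL
    linarith
  have hpow : (15 / 16 : ℝ) ^ m ≤ δ :=
    calc (15 / 16 : ℝ) ^ m ≤ Real.exp (-(1 / 16)) ^ m :=
          pow_le_pow_left₀ (by norm_num) (by linarith [Real.add_one_le_exp (-(1 / 16 : ℝ))]) m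
      _ = Real.exp (-(m / 16)) := by
          rw [← Real.exp_nat_mul]
          congr 1
          ring
      _ ≤ Real.exp (Real.log δ) := Real.exp_le_exp.2 hlog
      _ = δ := Real.exp_log hδ
  linarith
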